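/- Consider $n$ agents with scalar states $x_i\in\mathbb R$ evolving in discrete time by $$x_i(k+1)=x_i(k)-\theta\sum_{j=1}^n a_{ij}\,f_{ij}\big(x_i(k)-x_j(k)\big),\qquad i=1,\dots,n,\ k\ge 0,$$ where $a_{ij}\in\{0,1\}$ and $a_{ii}=0$. Let $\mathcal G$ be the directed graph on $\{1,\dots,n\}$ that has the edge $(i,j)$ if and only if $a_{ij}=1$, and let $\mathcal N_i=\{j: a_{ij}=1\}$. Assume that, for some $L\ge 0$ and every edge $(i,j)$ of $\mathcal G$, the function $f_{ij}:\mathbb R\to\mathbb R$ is Lipschitz with constant $L$ and satisfies (i) $f_{ij}'(x)\ge 0$ for almost every $x\in\mathbb R$. Let $$0<\theta<\frac{1}{L\,\max_{i}|\mathcal N_i|},$$ where the upper bound is read as $+\infty$ if $L\max_i|\mathcal N_i|=0$. Then, if the system has at least one equilibrium point (a fixed point of the state update), for every initial state $x(0)\in\mathbb R^n$ the trajectory $x(k)$ converges as $k\to\infty$ to an equilibrium point. If, moreover, (ii) for every edge $(i,j)$ of $\mathcal G$, $f_{ij}(0)=0$ and $f_{ij}(x)\ne0$ for almost every $x$ in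 some neighborhood of $0$; (iii) $\mathcal G$ has a globally reachable node, i.e. a node $r$ such that from every node there is a directed path in $\mathcal G$ to $r$ (of length zero from $r$ itself); then for every initial state $x(0)\in\mathbb R^n$ the trajectory $x(k)$ converges as $k\to\infty$ to a consensus state, i.e. to a vector $\alpha\mathbf 1$ with $\alpha\in\mathbb R$, where $\mathbf 1$ is the all-ones vector. -/

import Mathlib

open Filter Topology MeasureTheory
open scoped NNReal

namespace ConsensusMAS

/-- `a` is a 0/1 adjacency matrix with zero diagonal. `a i j = 1` means that agent `i` is
influenced by agent `j`. -/
def IsAdjacency {n : ℕ} (a : Matrix (Fin n) (Fin n) ℝ) : Prop :=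
  (∀ i j, a i j = 0 ∨ a i j = 1) ∧ ∀ i, a i i = 0

/-- The directed graph of the interconnections: the edge `(i, j)` is present iff `a i j = 1`. -/
def interactionGraph {n : ℕ} (a : Matrix (Fin n) (Fin n) ℝ) : Digraph (Fin n) :=
  ⟨fun i j => a i j = 1⟩

open Classical in
/-- The set of neighbors of agent `i`: all `j` such that `(i, j)` is an edge. -/
noncomputable def neighbors {n : ℕ} (a : Matrix (Fin n) (Fin n) ℝ) (i : Fin n) : Finset (Fin n) :=
  Finset.univ.filter fun j => (interactionGraph a).Adj i j

/-- The largest number of neighbors of an agent. -/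
noncomputable def maxNeighbors {n : ℕ} (a : Matrix (Fin n) (Fin n) ℝ) : ℕ :=
  Finset.univ.sup fun i => (neighbors a i).card

/-- A node `r` is globally reachable if every node is joined to `r` by a directed path
(of length zero for `r` itself). -/
def IsGloballyReachable {V : Type*} (G : Digraph V) (r : V) : Prop :=
  ∀ i, Relation.ReflTransGen G.Adj i r

/-- One step of the agents' dynamics. -/
noncomputable def step {n : ℕ} (θ : ℝ) (a : Matrix (Fin n) (Fin n) ℝ)
    (f : Fin n → Fin n → ℝ → ℝ) (x : Fin n → ℝ) : Fin n → ℝ :=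
  fun i => x i - θ * ∑ j, a i j * f i j (x i - x j)

/-- A state trajectory of the system (with arbitrary initial state `x 0`). -/
def IsTrajectory {n : ℕ} (θ : ℝ) (a : Matrix (Fin n) (Fin n) ℝ)
    (f : Fin n → Fin n → ℝ → ℝ) (x : ℕ → Fin n → ℝ) : Prop :=
  ∀ k, x (k + 1) = step θ a f (x k)

/-- An equilibrium point of the system. -/
def IsEquilibrium {n : ℕ} (θ : ℝ) (a : Matrix (Fin n) (Fin n) ℝ)
    (f : Fin n → Fin n → ℝ → ℝ) (x : Fin n → ℝ) : Prop :=
  step θ a f x = x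

/-- The consensus set: the multiples of the all-ones vector. -/
def consensusSet (n : ℕ) : Set (Fin n → ℝ) :=
  {x | ∃ α : ℝ, x = fun _ => α}

end ConsensusMAS

namespace ConsensusMAS

/-! By the fundamental theorem of calculus each `f i j` is monotone. The step-size bound then leaves
each agent a positive weight on its own state, so the step map is nonexpansive in the sup metric and
satisfies `IsAveraging`. Nonexpansiveness alone would allow periodic orbits;
`IsAveraging.step_length_eq_zero` excludes them. On the orbit of a limit point the step length is
constant, and a step of that length in one coordinate forces equal steps in it at all earlier times,
against boundedness. So limit points are fixed, and the orbit converges. For consensus, extremal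
values of an equilibrium spread along edges to the globally reachable node, where maximum and
minimum meet. -/

/-- A Lipschitz function whose derivative is nonnegative almost everywhere is monotone. -/
theorem monotone_of_lipschitz_of_ae_deriv_nonneg {g : ℝ → ℝ} {L : ℝ≥0} (hL : LipschitzWith L g)
    (hg : ∀ᵐ x ∂(volume : Measure ℝ), 0 ≤ deriv g x) : Monotone g := by
  intro u v huv
  have hac : AbsolutelyContinuousOnInterval g u v :=
    (hL.lipschitzOnWith (s := Set.uIcc u v)).absolutelyContinuousOnInterval
  have h := hac.integral_deriv_eq_sub
  have h0 : 0 ≤ ∫ x in u..v, deriv g x := intervalIntegral.integral_nonneg_of_ae huv hg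
  linarith

/-- A monotone function that vanishes at `0`, but almost nowhere near `0`, vanishes only at `0`. -/
theorem eq_zero_of_monotone_of_ae_ne_zero {g : ℝ → ℝ} (hg : Monotone g) (h0 : g 0 = 0)
    {U : Set ℝ} (hU : U ∈ 𝓝 (0 : ℝ)) (hne : ∀ᵐ x ∂(volume : Measure ℝ), x ∈ U → g x ≠ 0)
    {x : ℝ} (hx : g x = 0) : x = 0 := by
  obtain ⟨ε, hε, hεU⟩ := Metric.mem_nhds_iff.1 hU
  -- By monotonicity `g` vanishes between a zero and `0`; cutting at distance `ε` from `0` keeps the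
  -- interval inside `U`.
  have key : ∀ p q : ℝ, p < q → (∀ z ∈ Set.Ioo p q, z ∈ U ∧ g z = 0) → False := by
    intro p q hpq hz
    have hsub : Set.Ioo p q ⊆ {z | ¬ (z ∈ U → g z ≠ 0)} := fun z hzm h =>
      h (hz z hzm).1 (hz z hzm).2
    have hnull := measure_mono_null hsub (ae_iff.1 hne)
    rw [Real.volume_Ioo, ENNReal.ofReal_eq_zero] at hnull
    linarith
  rcases lt_trichotomy x 0 with h | h | h
  · refine (key (max x (-ε)) 0 (max_lt h (neg_lt_zero.2 hε)) fun z hz => ⟨hεU ?_, ?_⟩).elim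
    · have := (max_lt_iff.1 hz.1).2
      rw [Metric.mem_ball, Real.dist_0_eq_abs, abs_lt]
      exact ⟨this, hz.2.trans hε⟩
    · exact le_antisymm (h0 ▸ hg hz.2.le) (hx ▸ hg (max_lt_iff.1 hz.1).1.le)
  · exact h
  · refine (key 0 (min x ε) (lt_min h hε) fun z hz => ⟨hεU ?_, ?_⟩).elim
    · have := (lt_min_iff.1 hz.2).2
      rw [Metric.mem_ball, Real.dist_0_eq_abs, abs_lt]
      exact ⟨(neg_lt_zero.2 hε).trans hz.1, this⟩
    · exact le_antisymm (hx ▸ hg (lt_min_iff.1 hz.2).1.le) (h0 ▸ hg hz.1.le)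

/-! ### Averaging maps and their orbits in the sup metric -/

/-- `F` contracts the gap to any upper bound of a coordinatewise difference no faster than by the
positive factor `η i` in coordinate `i`: differences of values of `F` are weighted averages of the
differences of the arguments, with weight at least `η i` on coordinate `i` itself. -/
def IsAveraging {ι : Type*} (F : (ι → ℝ) → ι → ℝ) (η : ι → ℝ) : Prop :=
  (∀ i, 0 < η i) ∧ ∀ x y d, (∀ j, x j - y j ≤ d) →
    ∀ i, η i * (d - (x i - y i)) ≤ d - (F x i - F y i)

section Averaging

variable {ι : Type*} {F : (ι → ℝ) → ι → ℝ} {η : ι → ℝ}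

theorem IsAveraging.sub_le (hF : IsAveraging F η) {x y : ι → ℝ} {d : ℝ}
    (h : ∀ j, x j - y j ≤ d) (i : ι) : F x i - F y i ≤ d := by
  have h1 := hF.2 x y d h i
  have h2 := mul_nonneg (hF.1 i).le (sub_nonneg.2 (h i))
  linarith

/-- This is where `0 < η i` matters: a maximal gap in coordinate `i` after the map was already
maximal, in the same coordinate, before it. -/
theorem IsAveraging.sub_eq (hF : IsAveraging F η) {x y : ι → ℝ} {d : ℝ}
    (h : ∀ j, x j - y j ≤ d) {i : ι} (hi : F x i - F y i = d) : x i - y i = d := by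
  have h1 := hF.2 x y d h i
  rw [hi, sub_self] at h1
  have h2 := nonpos_of_mul_nonpos_right h1 (hF.1 i)
  linarith [h i]

variable [Fintype ι]

theorem sub_le_dist_pi (x y : ι → ℝ) (j : ι) : x j - y j ≤ dist x y :=
  (le_abs_self _).trans (dist_le_pi_dist x y j)

theorem IsAveraging.lipschitzWith_one (hF : IsAveraging F η) : LipschitzWith 1 F := by
  refine LipschitzWith.of_dist_le_mul fun x y => ?_
  rw [NNReal.coe_one, one_mul, dist_pi_le_iff dist_nonneg]
  intro i
  rw [Real.dist_eq, abs_le]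
  have h1 := hF.sub_le (sub_le_dist_pi x y) i
  have h2 := hF.sub_le (sub_le_dist_pi y x) i
  rw [dist_comm] at h2
  constructor <;> linarith

/-- An increment of maximal size in coordinate `i` is preceded by equal increments only. -/
theorem IsAveraging.sub_zero_eq_of_step_eq (hF : IsAveraging F η) {y : ℕ → ι → ℝ}
    (hy : ∀ k, y (k + 1) = F (y k)) {d : ℝ} (hd : ∀ k, dist (y (k + 1)) (y k) = d) {i : ι}
    (K : ℕ) (hK : y (K + 1) i - y K i = d) : y (K + 1) i - y 0 i = (K + 1) * d := by
  induction K with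
  | zero => simpa using hK
  | succ K ih =>
    have h := ih (hF.sub_eq (fun j => hd K ▸ sub_le_dist_pi _ _ j) (by rwa [← hy, ← hy]))
    push_cast
    linarith

/-- A decrement of maximal size in coordinate `i` is preceded by equal decrements only. -/
theorem IsAveraging.zero_sub_eq_of_step_eq (hF : IsAveraging F η) {y : ℕ → ι → ℝ}
    (hy : ∀ k, y (k + 1) = F (y k)) {d : ℝ} (hd : ∀ k, dist (y (k + 1)) (y k) = d) {i : ι}
    (K : ℕ) (hK : y K i - y (K + 1) i = d) : y 0 i - y (K + 1) i = (K + 1) * d := by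
  induction K with
  | zero => simpa using hK
  | succ K ih =>
    have h := ih (hF.sub_eq (fun j => hd K ▸ dist_comm (y (K + 1)) (y K) ▸ sub_le_dist_pi _ _ j)
      (by rwa [← hy, ← hy]))
    push_cast
    linarith

/-- A bounded orbit with steps of constant length is stationary. -/
theorem IsAveraging.step_length_eq_zero (hF : IsAveraging F η) {y : ℕ → ι → ℝ}
    (hy : ∀ k, y (k + 1) = F (y k)) {d : ℝ} (hd : ∀ k, dist (y (k + 1)) (y k) = d) {B : ℝ}
    (hB : ∀ k, dist (y k) (y 0) ≤ B) : d = 0 := by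
  by_contra hne
  have hd0 : 0 < d := lt_of_le_of_ne (hd 0 ▸ dist_nonneg) (Ne.symm hne)
  -- A coordinate realizing `d` at time `K` has moved `(K + 1) * d > B` since time `0`.
  obtain ⟨K, hK⟩ := exists_nat_gt (B / d)
  rw [div_lt_iff₀ hd0] at hK
  have hmax : ∃ i, d ≤ dist (y (K + 1) i) (y K i) := by
    by_contra! h
    exact (((dist_pi_lt_iff hd0).2 h).trans_eq (hd K).symm).false
  obtain ⟨i, hi⟩ := hmax
  have hB1 := (sub_le_dist_pi (y (K + 1)) (y 0) i).trans (hB _)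
  have hB2 := (sub_le_dist_pi (y 0) (y (K + 1)) i).trans ((dist_comm _ _).trans_le (hB (K + 1)))
  have hle1 := hd K ▸ sub_le_dist_pi (y (K + 1)) (y K) i
  have hle2 := hd K ▸ dist_comm (y (K + 1)) (y K) ▸ sub_le_dist_pi (y K) (y (K + 1)) i
  rw [Real.dist_eq, le_abs] at hi
  rcases hi with hi | hi
  · have := hF.sub_zero_eq_of_step_eq hy hd K (le_antisymm hle1 hi)
    linarith
  · have := hF.zero_sub_eq_of_step_eq hy hd K (le_antisymm hle2 (by linarith))
    linarith

/-- Every orbit of an averaging map with a fixed point converges to a fixed point. -/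
theorem IsAveraging.exists_tendsto_fixed (hF : IsAveraging F η) {p : ι → ℝ} (hp : F p = p)
    {x : ℕ → ι → ℝ} (hx : ∀ k, x (k + 1) = F (x k)) :
    ∃ y, F y = y ∧ Tendsto x atTop (𝓝 y) := by
  have hne : ∀ u v, dist (F u) (F v) ≤ dist u v := fun u v => by
    simpa using hF.lipschitzWith_one.dist_le_mul u v
  have hcont : Continuous F := hF.lipschitzWith_one.continuous
  have hanti : ∀ q, F q = q → Antitone fun k => dist (x k) q := fun q hq =>
    antitone_nat_of_succ_le fun k => by
      have := hne (x k) q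
      rwa [hq, ← hx] at this
  have hbdd : ∀ k, x k ∈ Metric.closedBall p (dist (x 0) p) := fun k => hanti p hp (Nat.zero_le k)
  obtain ⟨y, -, φ, hφ, hlim⟩ := tendsto_subseq_of_bounded Metric.isBounded_closedBall hbdd
  have hstep : Antitone fun k => dist (x (k + 1)) (x k) := antitone_nat_of_succ_le fun k => by
    have := hne (x (k + 1)) (x k)
    rwa [← hx, ← hx] at this
  have hstep_lim := tendsto_atTop_ciInf hstep
    ⟨0, by rintro _ ⟨k, rfl⟩; exact dist_nonneg⟩
  set d := ⨅ k, dist (x (k + 1)) (x k)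
  have hiter : ∀ m, Tendsto (fun k => x (φ k + m)) atTop (𝓝 (F^[m] y)) := by
    intro m
    induction m with
    | zero => exact hlim
    | succ m ih =>
      rw [Function.iterate_succ_apply']
      exact ((hcont.tendsto _).comp ih).congr fun k => (hx (φ k + m)).symm
  -- The step lengths of `x` decrease to `d`, so every step on the orbit of the limit point has
  -- length exactly `d`.
  have hd : ∀ m, dist (F^[m + 1] y) (F^[m] y) = d := fun m =>
    tendsto_nhds_unique ((hiter (m + 1)).dist (hiter m))
      (hstep_lim.comp (tendsto_atTop_mono (fun k => Nat.le_add_right _ m) hφ.tendsto_atTop))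
  have hmem : ∀ m, F^[m] y ∈ Metric.closedBall p (dist (x 0) p) := fun m =>
    Metric.isClosed_closedBall.mem_of_tendsto (hiter m) (Eventually.of_forall fun k => hbdd _)
  have hd0 : d = 0 := hF.step_length_eq_zero (y := fun m => F^[m] y)
    (fun k => Function.iterate_succ_apply' F k y) hd
    (B := dist (x 0) p + dist (x 0) p)
    (fun m => (dist_triangle_right _ _ p).trans (add_le_add (hmem m) (hmem 0)))
  have hy : F y = y := dist_eq_zero.1 ((hd 0).trans hd0)
  refine ⟨y, hy, tendsto_iff_dist_tendsto_zero.2 ?_⟩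
  -- The distance to the fixed point `y` is antitone, so its limit along a subsequence decides.
  exact (tendsto_iff_tendsto_subseq_of_antitone (hanti y hy) hφ.tendsto_atTop).2
    (tendsto_iff_dist_tendsto_zero.1 hlim)

end Averaging

/-! ### The agents' step map and its equilibria -/

section Agents

variable {n : ℕ} {a : Matrix (Fin n) (Fin n) ℝ} {f : Fin n → Fin n → ℝ → ℝ} {θ : ℝ}

theorem sum_interactions (ha : IsAdjacency a) (i : Fin n) (g : Fin n → ℝ) :
    ∑ j, a i j * g j = ∑ j ∈ neighbors a i, g j := by
  classical
  rw [neighbors, Finset.sum_filter]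
  refine Finset.sum_congr rfl fun j _ => ?_
  change _ = if a i j = 1 then g j else 0
  rcases ha.1 i j with h | h <;> simp [h]

theorem mem_neighbors {i j : Fin n} :
    j ∈ neighbors a i ↔ (interactionGraph a).Adj i j := by
  simp [neighbors]

theorem card_neighbors_le (a : Matrix (Fin n) (Fin n) ℝ) (i : Fin n) :
    (neighbors a i).card ≤ maxNeighbors a :=
  Finset.le_sup (f := fun i => (neighbors a i).card) (Finset.mem_univ i)

theorem isEquilibrium_iff (ha : IsAdjacency a) (hθ : 0 < θ) {x : Fin n → ℝ} :
    IsEquilibrium θ a f x ↔ ∀ i, ∑ j ∈ neighbors a i, f i j (x i - x j) = 0 := by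
  simp only [IsEquilibrium, funext_iff, step, sum_interactions ha, sub_eq_self, mul_eq_zero,
    hθ.ne', false_or]

/-- For small step sizes, one step of the agents is an averaging map. -/
theorem isAveraging_step (ha : IsAdjacency a) {L : ℝ≥0}
    (hLip : ∀ i j, (interactionGraph a).Adj i j → LipschitzWith L (f i j))
    (hmono : ∀ i j, (interactionGraph a).Adj i j → Monotone (f i j)) (hθ : 0 < θ)
    (hθL : θ * (L * maxNeighbors a) < 1) :
    IsAveraging (step θ a f) fun i => 1 - θ * ((neighbors a i).card * L) := by
  refine ⟨fun i => ?_, fun x y d hd i => ?_⟩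
  · have h1 : ((neighbors a i).card : ℝ) ≤ maxNeighbors a := by
      exact_mod_cast card_neighbors_le a i
    have h2 := mul_le_mul_of_nonneg_left (mul_le_mul_of_nonneg_right h1 L.coe_nonneg) hθ.le
    change 0 < 1 - θ * ((neighbors a i).card * L)
    linarith [mul_comm (L : ℝ) (maxNeighbors a)]
  · have hsum : -((neighbors a i).card * (L * (d - (x i - y i)))) ≤
        ∑ j ∈ neighbors a i, (f i j (x i - x j) - f i j (y i - y j)) := by
      rw [← mul_neg, ← nsmul_eq_mul]
      refine Finset.card_nsmul_le_sum _ _ _ fun j hj => ?_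
      have hadj := mem_neighbors.1 hj
      have hLd : 0 ≤ L * (d - (x i - y i)) := mul_nonneg L.coe_nonneg (sub_nonneg.2 (hd i))
      -- If the argument of `f i j` grows, monotonicity suffices. If it drops, it does so by at most
      -- `d - (x i - y i)`, since `x j - y j ≤ d`, and the Lipschitz bound applies.
      rcases le_total (y i - y j) (x i - x j) with h | h
      · linarith [hmono i j hadj h]
      · have h1 := (hLip i j hadj).dist_le_mul (x i - x j) (y i - y j)
        rw [Real.dist_eq, Real.dist_eq, abs_of_nonpos (sub_nonpos.2 h)] at h1
        have h2 : L * -(x i - x j - (y i - y j)) ≤ L * (d - (x i - y i)) :=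
          mul_le_mul_of_nonneg_left (by linarith [hd j]) L.coe_nonneg
        linarith [neg_abs_le (f i j (x i - x j) - f i j (y i - y j))]
    rw [Finset.sum_sub_distrib] at hsum
    have := mul_le_mul_of_nonneg_left hsum hθ.le
    simp only [step, sum_interactions ha]
    linarith

/-- Along every edge out of a node, an equilibrium cannot leave the set of coordinates with
maximal value. -/
theorem apply_eq_of_isMax_of_adj
    (hmono : ∀ i j, (interactionGraph a).Adj i j → Monotone (f i j))
    (hzero : ∀ i j, (interactionGraph a).Adj i j → ∀ z, f i j z = 0 ↔ z = 0)
    {x : Fin n → ℝ} (hx : ∀ i, ∑ j ∈ neighbors a i, f i j (x i - x j) = 0)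
    {i j : Fin n} (hij : (interactionGraph a).Adj i j) (hi : ∀ k, x k ≤ x i) : x j = x i := by
  have hnonneg : ∀ k ∈ neighbors a i, 0 ≤ f i k (x i - x k) := fun k hk => by
    have hadj := mem_neighbors.1 hk
    rw [← (hzero i k hadj 0).2 rfl]
    exact hmono i k hadj (sub_nonneg.2 (hi k))
  have h := (Finset.sum_eq_zero_iff_of_nonneg hnonneg).1 (hx i) j (mem_neighbors.2 hij)
  linarith [(hzero i j hij _).1 h]

/-- Along every edge out of a node, an equilibrium cannot leave the set of coordinates with
minimal value. -/
theorem apply_eq_of_isMin_of_adj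
    (hmono : ∀ i j, (interactionGraph a).Adj i j → Monotone (f i j))
    (hzero : ∀ i j, (interactionGraph a).Adj i j → ∀ z, f i j z = 0 ↔ z = 0)
    {x : Fin n → ℝ} (hx : ∀ i, ∑ j ∈ neighbors a i, f i j (x i - x j) = 0)
    {i j : Fin n} (hij : (interactionGraph a).Adj i j) (hi : ∀ k, x i ≤ x k) : x j = x i := by
  have hnonpos : ∀ k ∈ neighbors a i, f i k (x i - x k) ≤ 0 := fun k hk => by
    have hadj := mem_neighbors.1 hk
    rw [← (hzero i k hadj 0).2 rfl]
    exact hmono i k hadj (sub_nonpos.2 (hi k))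
  have h := (Finset.sum_eq_zero_iff_of_nonpos hnonpos).1 (hx i) j (mem_neighbors.2 hij)
  linarith [(hzero i j hij _).1 h]

/-- Equilibria are consensus states if some node is globally reachable. -/
theorem mem_consensusSet_of_equilibrium
    (hmono : ∀ i j, (interactionGraph a).Adj i j → Monotone (f i j))
    (hzero : ∀ i j, (interactionGraph a).Adj i j → ∀ z, f i j z = 0 ↔ z = 0)
    {r : Fin n} (hr : IsGloballyReachable (interactionGraph a) r)
    {x : Fin n → ℝ} (hx : ∀ i, ∑ j ∈ neighbors a i, f i j (x i - x j) = 0) :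
    x ∈ consensusSet n := by
  have : Nonempty (Fin n) := ⟨r⟩
  obtain ⟨M, hM⟩ := Finite.exists_max x
  obtain ⟨m, hm⟩ := Finite.exists_min x
  have hrM : x r = x M := by
    have hpath := hr M
    clear hr
    induction hpath with
    | refl => rfl
    | tail _ hbc ih =>
      exact (apply_eq_of_isMax_of_adj hmono hzero hx hbc (fun k => ih ▸ hM k)).trans ih
  have hrm : x r = x m := by
    have hpath := hr m
    clear hr hrM
    induction hpath with
    | refl => rfl
    | tail _ hbc ih =>
      exact (apply_eq_of_isMin_of_adj hmono hzero hx hbc (fun k => ih ▸ hm k)).trans ih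
  exact ⟨x r, funext fun i => le_antisymm (hrM ▸ hM i) (hrm ▸ hm i)⟩

end Agents

end ConsensusMAS

theorem theorem5p1 {n : ℕ} (a : Matrix (Fin n) (Fin n) ℝ)
    (ha : ConsensusMAS.IsAdjacency a)
    (f : Fin n → Fin n → ℝ → ℝ) (L : ℝ≥0)
    (hLip : ∀ i j, (ConsensusMAS.interactionGraph a).Adj i j → LipschitzWith L (f i j))
    (hmono : ∀ i j, (ConsensusMAS.interactionGraph a).Adj i j →
      ∀ᵐ x ∂(volume : Measure ℝ), 0 ≤ deriv (f i j) x)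
    (θ : ℝ) (hθ_pos : 0 < θ)
    -- the upper bound on the step size, read as `+∞` when `L * max |N_i| = 0`
    (hθ_lt : 0 < (L : ℝ) * (ConsensusMAS.maxNeighbors a : ℝ) →
      θ < 1 / ((L : ℝ) * (ConsensusMAS.maxNeighbors a : ℝ))) :
    ((∃ xe, ConsensusMAS.IsEquilibrium θ a f xe) →
      ∀ x : ℕ → Fin n → ℝ, ConsensusMAS.IsTrajectory θ a f x →
        ∃ xe, ConsensusMAS.IsEquilibrium θ a f xe ∧ Tendsto x atTop (𝓝 xe)) ∧
    ((∀ i j, (ConsensusMAS.interactionGraph a).Adj i j →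
        f i j 0 = 0 ∧ ∃ U ∈ 𝓝 (0 : ℝ), ∀ᵐ x ∂(volume : Measure ℝ), x ∈ U → f i j x ≠ 0) →
      (∃ r, ConsensusMAS.IsGloballyReachable (ConsensusMAS.interactionGraph a) r) →
      ∀ x : ℕ → Fin n → ℝ, ConsensusMAS.IsTrajectory θ a f x →
        ∃ xc ∈ ConsensusMAS.consensusSet n, Tendsto x atTop (𝓝 xc)) := by
  have hmono' : ∀ i j, (ConsensusMAS.interactionGraph a).Adj i j → Monotone (f i j) :=
    fun i j h => ConsensusMAS.monotone_of_lipschitz_of_ae_deriv_nonneg (hLip i j h) (hmono i j h)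
  have hθL : θ * (L * ConsensusMAS.maxNeighbors a) < 1 := by
    rcases (mul_nonneg L.coe_nonneg (Nat.cast_nonneg (ConsensusMAS.maxNeighbors a))).lt_or_eq
      with h | h
    · exact (lt_div_iff₀ h).1 (hθ_lt h)
    · rw [← h, mul_zero]
      exact one_pos
  have hconv : (∃ xe, ConsensusMAS.IsEquilibrium θ a f xe) →
      ∀ x : ℕ → Fin n → ℝ, ConsensusMAS.IsTrajectory θ a f x →
        ∃ xe, ConsensusMAS.IsEquilibrium θ a f xe ∧ Tendsto x atTop (𝓝 xe) :=
    fun ⟨_, hp⟩ _ hx =>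
      (ConsensusMAS.isAveraging_step ha hLip hmono' hθ_pos hθL).exists_tendsto_fixed hp hx
  refine ⟨hconv, fun hf ⟨r, hr⟩ x hx => ?_⟩
  have hzero : ∀ i j, (ConsensusMAS.interactionGraph a).Adj i j → ∀ z, f i j z = 0 ↔ z = 0 := by
    intro i j hij z
    obtain ⟨h0, U, hU, hne⟩ := hf i j hij
    exact ⟨ConsensusMAS.eq_zero_of_monotone_of_ae_ne_zero (hmono' i j hij) h0 hU hne,
      fun h => h ▸ h0⟩
  -- The origin supplies the equilibrium that convergence needs.
  have heq : ConsensusMAS.IsEquilibrium θ a f 0 :=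
    (ConsensusMAS.isEquilibrium_iff ha hθ_pos).2 fun i => Finset.sum_eq_zero fun j hj =>
      (hzero i j (ConsensusMAS.mem_neighbors.1 hj) _).2 (sub_self _)
  obtain ⟨xe, hxe, hlim⟩ := hconv ⟨0, heq⟩ x hx
  exact ⟨xe, ConsensusMAS.mem_consensusSet_of_equilibrium hmono' hzero hr
    ((ConsensusMAS.isEquilibrium_iff ha hθ_pos).1 hxe), hlim⟩
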